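/- Setting. Let $\Gamma$ be a countably infinite, totally ordered set of values. A schema $\mathcal G$ consists of relation names with arities and of a set of integrity constraints of two kinds: denial constraints $\forall \vec x_1,\dots,\vec x_m\ \neg[g_1(\vec x_1)\wedge\dots\wedge g_m(\vec x_m)\wedge\sigma(\vec x_1,\dots,\vec x_m)]$ with $m\ge 1$, where $\sigma$ is a conjunction of comparisons $X\odot X'$, $\odot\in\{\le,\ge,<,>,\ne\}$, between variables occurring in $\vec x_1,\dots,\vec x_m$; and inclusion dependencies $\forall\vec x_\forall\,[\,\exists \vec x_{1\exists}\, g_1(\vec x_1)\to\exists\vec x_{2\exists}\,g_2(\vec x_2)\,]$, where the variables within each $\vec x_i$ are distinct, $\vec x_\forall$ are the variables common to $\vec x_1$ and $\vec x_2$, and $\vec x_{i\exists}$ are the remaining variables of $\vec x_i$. The inclusion dependencies may be cyclic. A database is a set of facts $g(t)$ with $t$ a tuple over $\Gamma$ of the arity of $g$. A CM-complete repair of a database $D$ is a subset of $D$ that satisfies all constraints and is not strictly contained in another such subset. A query $q(\vec x)$ is a union of conjunctive queries, i.e. a non-empty disjunction of existentially quantified conjunctions $g_1(\vec y_1)\wedge\dots\wedge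 g_m(\vec y_m)\wedge\sigma(\vec y_1,\dots,\vec y_m)$ of the same form as above ($m\ge1$), each with free variables $\vec x$. A tuple $t$ over $\Gamma$ is a consistent answer to $q$ if $t$ is an answer to $q$ in every CM-complete repair of $D$. Program. $P_{cqa}$ uses predicates $g, g^c, g^r$ for each relation name $g$, and $Q_{cqa}$. It consists of the following rules: (1) for each denial constraint as above, $g_1^c(\vec x_1)\vee\dots\vee g_m^c(\vec x_m)\leftarrow g_1(\vec x_1),\dots,g_m(\vec x_m),\sigma(\vec x_1,\dots,\vec x_m)$; (2) for each inclusion dependency as above with $|\vec x_{2\exists}|>0$, $g_1^c(\vec x_1)\leftarrow g_1(\vec x_1),\ \#\mathrm{count}\{\vec x_{2\exists}:g_2^c(\vec x_2)\}=\#\mathrm{count}\{\vec x_{2\exists}:g_2(\vec x_2)\}$; and for each one with $|\vec x_{2\exists}|=0$, the two rules $g_1^c(\vec x_1)\leftarrow g_1(\vec x_1),g_2^c(\vec x_2)$ and $g_1^c(\vec x_1)\leftarrow g_1(\vec x_1),\mathrm{not}\ g_2(\vec x_2)$; (3) for each relation name $g$, $g^r(\vec x)\leftarrow g(\vec x),\mathrm{not}\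 g^c(\vec x)$; (4) for each disjunct of $q(\vec x)$ as above, $Q_{cqa}(\vec x)\leftarrow g_1^r(\vec y_1),\dots,g_m^r(\vec y_m),\sigma(\vec y_1,\dots,\vec y_m)$. An answer set of a program is a set $A$ of ground atoms that is a $\subseteq$-minimal model of the set of those ground instances of rules whose body is true in $A$ (the Faber–Leone–Pfeifer semantics for programs with possibly recursive aggregates). A cautious consequence is a ground atom true in every answer set. Theorem. Let $D$ be a finite, possibly inconsistent database for a schema $\mathcal G$ with arbitrary denial constraints and possibly cyclic inclusion dependencies, and let $q$ be a union of conjunctive queries. Then a tuple $t$ is a consistent answer to $q$ w.r.t. $D$ under the CM-complete semantics if and only if $Q_{cqa}(t)$ is a cautious consequence of $D\cup P_{cqa}$. Moreover, the map $A\mapsto\{g(t): g^r(t)\in A\}$ is a bijection from the answer sets of $D\cup P_{cqa}$ onto the CM-complete repairs of $D$. -/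

import Mathlib

namespace CQA

/-! ### Relational databases, integrity constraints and queries -/

/-- Variables. -/
abbrev Var := ℕ

/-- The comparison operators `≤, ≥, <, >, ≠`
(equality is expressed by repeating a variable). -/
inductive Cmp where
  | le | ge | lt | gt | ne

def Cmp.Holds {Γ : Type*} [LinearOrder Γ] : Cmp → Γ → Γ → Prop
  | .le, a, b => a ≤ b
  | .ge, a, b => a ≥ b
  | .lt, a, b => a < b
  | .gt, a, b => a > b
  | .ne, a, b => a ≠ b

/-- An atom `p(x₁, …, xₙ)` with `n = ar p`, over predicate symbols `P` with arities `ar`,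
and with arguments in `T`.  For `T` a set of values this is a fact. -/
@[ext]
structure Atom {P : Type*} (ar : P → ℕ) (T : Type*) where
  pred : P
  args : Fin (ar pred) → T

def Atom.map {P T U : Type*} {ar : P → ℕ} (f : T → U) (a : Atom ar T) : Atom ar U :=
  ⟨a.pred, fun i => f (a.args i)⟩

/-- A comparison atom `X ⊙ X'`. -/
structure Comparison where
  left : Var
  op : Cmp
  right : Var

/-- The variable `x` occurs in one of the atoms of the list. -/
def OccursIn {P : Type*} {ar : P → ℕ} (x : Var) (l : List (Atom ar Var)) : Prop :=
  ∃ a ∈ l, ∃ i, a.args i = x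

/-- A conjunction `r₁(x₁) ∧ … ∧ rₘ(xₘ) ∧ σ(x₁, …, xₘ)` with `m ≥ 1`. -/
structure Conj {R : Type*} (ar : R → ℕ) where
  atoms : List (Atom ar Var)
  comps : List Comparison
  atoms_ne : atoms ≠ []
  safe : ∀ c ∈ comps, OccursIn c.left atoms ∧ OccursIn c.right atoms

/-- Truth of a conjunction in the database `B` under the valuation `ν`. -/
def Conj.Holds {R Γ : Type*} [LinearOrder Γ] {ar : R → ℕ} (c : Conj ar)
    (B : Set (Atom ar Γ)) (ν : Var → Γ) : Prop :=
  (∀ a ∈ c.atoms, a.map ν ∈ B) ∧ ∀ k ∈ c.comps, k.op.Holds (ν k.left) (ν k.right)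

/-- An inclusion dependency `r₁(x₁) → ∃ x₂∃, r₂(x₂)`.  The variables within `x₁` are distinct,
and so are those within `x₂`.  The variables shared by `x₁` and `x₂` are the universally
quantified `x∀`; the other variables of `x₂` are existentially quantified. -/
structure IND {R : Type*} (ar : R → ℕ) where
  lhs : Atom ar Var
  rhs : Atom ar Var
  lhs_inj : Function.Injective lhs.args
  rhs_inj : Function.Injective rhs.args

/-- The sequence `x₂∃ = x₂ - x∀`. -/
def IND.exVars {R : Type*} {ar : R → ℕ} (d : IND ar) : List Var :=
  (List.ofFn d.rhs.args).filter (fun x => x ∉ List.ofFn d.lhs.args)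

/-- A database schema on the relation names `R`: arities, denial constraints
(a conjunction `c` stands for `∀ x₁ … xₘ, ¬ c`) and inclusion dependencies. -/
structure Schema (R : Type*) where
  arity : R → ℕ
  dcs : Set (Conj arity)
  inds : Set (IND arity)

/-- A set of facts over the schema, with values in `Γ`. -/
abbrev Database {R : Type*} (G : Schema R) (Γ : Type*) := Set (Atom G.arity Γ)

/-- `B` satisfies the denial constraint `∀ x₁ … xₘ, ¬ c`. -/
def SatisfiesDC {R Γ : Type*} [LinearOrder Γ] {ar : R → ℕ} (B : Set (Atom ar Γ))
    (c : Conj ar) : Prop :=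
  ∀ ν : Var → Γ, ¬ c.Holds B ν

/-- `B` satisfies the inclusion dependency `d`. -/
def SatisfiesIND {R Γ : Type*} {ar : R → ℕ} (B : Set (Atom ar Γ)) (d : IND ar) : Prop :=
  ∀ ν : Var → Γ, d.lhs.map ν ∈ B →
    ∃ w : Var → Γ, (∀ x ∈ Set.range d.lhs.args ∩ Set.range d.rhs.args, w x = ν x) ∧
      d.rhs.map w ∈ B

/-- `B` is consistent: all integrity constraints of the schema hold. -/
def Consistent {R Γ : Type*} [LinearOrder Γ] (G : Schema R) (B : Database G Γ) : Prop :=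
  (∀ c ∈ G.dcs, SatisfiesDC B c) ∧ ∀ d ∈ G.inds, SatisfiesIND B d

/-- A CM-complete repair of `D`: a consistent subset of `D` not strictly contained
in another one. -/
def IsCMRepair {R Γ : Type*} [LinearOrder Γ] (G : Schema R) (D B : Database G Γ) : Prop :=
  Consistent G B ∧ B ⊆ D ∧ ¬ ∃ B' : Database G Γ, B' ⊆ D ∧ Consistent G B' ∧ B ⊂ B'

/-- A union of conjunctive queries `cq₁(x) ∨ … ∨ cqₙ(x)` with `n ≥ 1`; `free` is the sequence
`x` of its free variables (without duplicates), each of which occurs in every disjunct.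
All other variables of a disjunct are existentially quantified. -/
structure UCQ {R : Type*} (ar : R → ℕ) where
  arity : ℕ
  free : Fin arity → Var
  free_inj : Function.Injective free
  disjuncts : List (Conj ar)
  disjuncts_ne : disjuncts ≠ []
  free_occurs : ∀ c ∈ disjuncts, ∀ i, OccursIn (free i) c.atoms

/-- The answer to the query `q` in the database `B`. -/
def UCQ.ans {R Γ : Type*} [LinearOrder Γ] {ar : R → ℕ} (q : UCQ ar) (B : Set (Atom ar Γ)) :
    Set (Fin q.arity → Γ) :=
  {t | ∃ c ∈ q.disjuncts, ∃ ν : Var → Γ, (∀ i, ν (q.free i) = t i) ∧ c.Holds B ν}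

/-- The consistent answer under the CM-complete semantics. -/
def ansCM {R Γ : Type*} [LinearOrder Γ] (G : Schema R) (D : Database G Γ) (q : UCQ G.arity) :
    Set (Fin q.arity → Γ) :=
  {t | ∀ B : Database G Γ, IsCMRepair G D B → t ∈ q.ans B}

/-! ### Disjunctive answer set programming with count aggregates -/

/-- A term: a variable or a constant. -/
inductive Term (Γ : Type*) where
  | var (x : Var)
  | const (a : Γ)

def Term.eval {Γ : Type*} (ν : Var → Γ) : Term Γ → Γ
  | .var x => ν x
  | .const a => a

/-- A symbolic set `{vars : conj}`.  The variables in `vars` are local to the set, all others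
are global. -/
structure SymbolicSet {P : Type*} (ar : P → ℕ) (Γ : Type*) where
  vars : List Var
  conj : List (Atom ar (Term Γ))

/-- Body literals: `a`, `not a`, `s ⊙ t`, and `#count S = #count T`. -/
inductive Literal {P : Type*} (ar : P → ℕ) (Γ : Type*) where
  | pos (a : Atom ar (Term Γ))
  | naf (a : Atom ar (Term Γ))
  | cmp (s : Term Γ) (op : Cmp) (t : Term Γ)
  | countEq (S T : SymbolicSet ar Γ)

/-- A rule: its head is read disjunctively, its body conjunctively. -/
structure Rule {P : Type*} (ar : P → ℕ) (Γ : Type*) where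
  head : List (Atom ar (Term Γ))
  body : List (Literal ar Γ)

/-- The value of a symbolic set in the interpretation `I`, the global variables being
instantiated by `ν`: the set of those instances of the sequence `vars` for which the
conjunction is true. -/
def SymbolicSet.value {P Γ : Type*} {ar : P → ℕ} (S : SymbolicSet ar Γ)
    (I : Set (Atom ar Γ)) (ν : Var → Γ) : Set (List Γ) :=
  {l | ∃ w : Var → Γ, (∀ x, x ∉ S.vars → w x = ν x) ∧
    (∀ a ∈ S.conj, a.map (Term.eval w) ∈ I) ∧ l = S.vars.map w}

def Literal.Holds {P Γ : Type*} [LinearOrder Γ] {ar : P → ℕ} (I : Set (Atom ar Γ))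
    (ν : Var → Γ) : Literal ar Γ → Prop
  | .pos a => a.map (Term.eval ν) ∈ I
  | .naf a => a.map (Term.eval ν) ∉ I
  | .cmp s op t => op.Holds (s.eval ν) (t.eval ν)
  | .countEq S T => (S.value I ν).encard = (T.value I ν).encard

def Rule.BodyHolds {P Γ : Type*} [LinearOrder Γ] {ar : P → ℕ} (r : Rule ar Γ)
    (I : Set (Atom ar Γ)) (ν : Var → Γ) : Prop :=
  ∀ l ∈ r.body, l.Holds I ν

def Rule.HeadHolds {P Γ : Type*} {ar : P → ℕ} (r : Rule ar Γ)
    (I : Set (Atom ar Γ)) (ν : Var → Γ) : Prop :=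
  ∃ a ∈ r.head, a.map (Term.eval ν) ∈ I

/-- The ground instances (a rule with an instantiation of its variables by constants) of the
program `Pr` whose body is true in `A`: the reduct of `Pr` with respect to `A` in the semantics
of Faber, Leone and Pfeifer for programs with (recursive) aggregates. -/
def reduct {P Γ : Type*} [LinearOrder Γ] {ar : P → ℕ} (Pr : Set (Rule ar Γ))
    (A : Set (Atom ar Γ)) : Set (Rule ar Γ × (Var → Γ)) :=
  {g | g.1 ∈ Pr ∧ g.1.BodyHolds A g.2}

/-- `I` is a model of a set of ground instances of rules. -/
def IsModel {P Γ : Type*} [LinearOrder Γ] {ar : P → ℕ} (S : Set (Rule ar Γ × (Var → Γ)))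
    (I : Set (Atom ar Γ)) : Prop :=
  ∀ g ∈ S, g.1.BodyHolds I g.2 → g.1.HeadHolds I g.2

/-- `A` is an answer set of `Pr`: a subset-minimal model of the reduct of `Pr` with respect
to `A`. -/
def IsAnswerSet {P Γ : Type*} [LinearOrder Γ] {ar : P → ℕ} (Pr : Set (Rule ar Γ))
    (A : Set (Atom ar Γ)) : Prop :=
  Minimal (IsModel (reduct Pr A)) A

/-- The ground atom `a` is a cautious consequence of `Pr`: it is true in every answer set. -/
def CautiousConsequence {P Γ : Type*} [LinearOrder Γ] {ar : P → ℕ} (Pr : Set (Rule ar Γ))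
    (a : Atom ar Γ) : Prop :=
  ∀ A, IsAnswerSet Pr A → a ∈ A

/-! ### The generated program -/

/-- The predicates of the generated program: `g`, `gᶜ`, `gʳ` for each relation name `g`, and
the query predicate. -/
inductive CqaPred (R : Type*) where
  | base (g : R)
  | del (g : R)
  | rep (g : R)
  | query

def cqaArity {R : Type*} (ar : R → ℕ) (n : ℕ) : CqaPred R → ℕ
  | .base g => ar g
  | .del g => ar g
  | .rep g => ar g
  | .query => n

section Generated

variable {R : Type*} {ar : R → ℕ}

/-- `g(x)` as an atom of the generated program. -/
def baseAtom {T : Type*} (n : ℕ) (a : Atom ar T) : Atom (cqaArity ar n) T :=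
  ⟨.base a.pred, a.args⟩

/-- `gᶜ(x)`. -/
def delAtom {T : Type*} (n : ℕ) (a : Atom ar T) : Atom (cqaArity ar n) T :=
  ⟨.del a.pred, a.args⟩

/-- `gʳ(x)`. -/
def repAtom {T : Type*} (n : ℕ) (a : Atom ar T) : Atom (cqaArity ar n) T :=
  ⟨.rep a.pred, a.args⟩

/-- `Q_cqa(x)`. -/
def queryAtom {T : Type*} (ar : R → ℕ) {n : ℕ} (t : Fin n → T) : Atom (cqaArity ar n) T :=
  ⟨.query, t⟩

/-- An atom on variables as an atom on terms. -/
def Atom.toTerm (Γ : Type*) (a : Atom ar Var) : Atom ar (Term Γ) := a.map Term.var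

/-- The fact `g(t)` as a rule with empty body. -/
def factRule {Γ : Type*} (n : ℕ) (f : Atom ar Γ) : Rule (cqaArity ar n) Γ where
  head := [baseAtom n (f.map Term.const)]
  body := []

def compLit (Γ : Type*) (n : ℕ) (k : Comparison) : Literal (cqaArity ar n) Γ :=
  .cmp (.var k.left) k.op (.var k.right)

/-- `g₁ᶜ(x₁) ∨ ⋯ ∨ gₘᶜ(xₘ) :- g₁(x₁), …, gₘ(xₘ), σ(x₁, …, xₘ).` -/
def dcRule (Γ : Type*) (n : ℕ) (c : Conj ar) : Rule (cqaArity ar n) Γ where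
  head := c.atoms.map fun a => delAtom n (a.toTerm Γ)
  body := (c.atoms.map fun a => .pos (baseAtom n (a.toTerm Γ))) ++ c.comps.map (compLit Γ n)

/-- `g₁ᶜ(x₁) :- g₁(x₁), #count{x₂∃ : g₂ᶜ(x₂)} = #count{x₂∃ : g₂(x₂)}.` -/
def indCountRule (Γ : Type*) (n : ℕ) (d : IND ar) : Rule (cqaArity ar n) Γ where
  head := [delAtom n (d.lhs.toTerm Γ)]
  body := [.pos (baseAtom n (d.lhs.toTerm Γ)),
    .countEq ⟨d.exVars, [delAtom n (d.rhs.toTerm Γ)]⟩ ⟨d.exVars, [baseAtom n (d.rhs.toTerm Γ)]⟩]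

/-- `g₁ᶜ(x₁) :- g₁(x₁), g₂ᶜ(x₂).` -/
def indDelRule (Γ : Type*) (n : ℕ) (d : IND ar) : Rule (cqaArity ar n) Γ where
  head := [delAtom n (d.lhs.toTerm Γ)]
  body := [.pos (baseAtom n (d.lhs.toTerm Γ)), .pos (delAtom n (d.rhs.toTerm Γ))]

/-- `g₁ᶜ(x₁) :- g₁(x₁), not g₂(x₂).` -/
def indNotRule (Γ : Type*) (n : ℕ) (d : IND ar) : Rule (cqaArity ar n) Γ where
  head := [delAtom n (d.lhs.toTerm Γ)]
  body := [.pos (baseAtom n (d.lhs.toTerm Γ)), .naf (baseAtom n (d.rhs.toTerm Γ))]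

/-- The rules generated for an inclusion dependency. -/
def indRules (Γ : Type*) (n : ℕ) (d : IND ar) : Set (Rule (cqaArity ar n) Γ) :=
  {r | (0 < d.exVars.length ∧ r = indCountRule Γ n d) ∨
    (d.exVars.length = 0 ∧ (r = indDelRule Γ n d ∨ r = indNotRule Γ n d))}

/-- The atom `g(X₁, …, Xₖ)` on distinct variables. -/
def genericAtom (ar : R → ℕ) (g : R) : Atom ar Var := ⟨g, fun i => (i : ℕ)⟩

/-- `gʳ(x) :- g(x), not gᶜ(x).` -/
def repRule (ar : R → ℕ) (Γ : Type*) (n : ℕ) (g : R) : Rule (cqaArity ar n) Γ where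
  head := [repAtom n ((genericAtom ar g).toTerm Γ)]
  body := [.pos (baseAtom n ((genericAtom ar g).toTerm Γ)),
    .naf (delAtom n ((genericAtom ar g).toTerm Γ))]

/-- `Q_cqa(x) :- g₁ʳ(y₁), …, gₘʳ(yₘ), σ(y₁, …, yₘ).` for a disjunct of the query. -/
def queryRule (Γ : Type*) (q : UCQ ar) (c : Conj ar) : Rule (cqaArity ar q.arity) Γ where
  head := [queryAtom ar fun i => .var (q.free i)]
  body := (c.atoms.map fun a => .pos (repAtom q.arity (a.toTerm Γ))) ++
    c.comps.map (compLit Γ q.arity)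

end Generated

/-- The program `P_cqa` generated from the schema and the query (CM-complete semantics). -/
def Pcqa {R : Type*} (G : Schema R) (Γ : Type*) (q : UCQ G.arity) :
    Set (Rule (cqaArity G.arity q.arity) Γ) :=
  {r | (∃ c ∈ G.dcs, r = dcRule Γ q.arity c) ∨
    (∃ d ∈ G.inds, r ∈ indRules Γ q.arity d) ∨
    (∃ g : R, r = repRule G.arity Γ q.arity g) ∨
    (∃ c ∈ q.disjuncts, r = queryRule Γ q c)}

/-- The database as a set of rules. -/
def factProgram {R Γ : Type*} {G : Schema R} (D : Database G Γ) (n : ℕ) :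
    Set (Rule (cqaArity G.arity n) Γ) :=
  factRule n '' D

/-- The database `{g(t) : gʳ(t) ∈ A}` described by an interpretation of the generated
program. -/
def repairedDB {R Γ : Type*} (G : Schema R) {n : ℕ} (A : Set (Atom (cqaArity G.arity n) Γ)) :
    Database G Γ :=
  {f | repAtom n f ∈ A}

end CQA

/-! The reduct treats `not` and `#count` as tests against the guess `A`, but below `A` and with `D`
fixed the rules for the constraints hold in `I` exactly if `D \ {g(t) : gᶜ(t) ∈ I}` is consistent:
as the deleted facts lie in `D` and only finitely many facts of `D` witness an instance of an
inclusion dependency, the two counts agree iff every witness has been deleted.  Deletions are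
minimized while `gʳ` and the query predicate stay fixed by the guess, so the answer sets correspond
to the inclusion-maximal consistent subsets of `D`.  Everything else in an answer set is determined
by these subsets, because each of its atoms is supported by a rule. -/

namespace CQA

section Reduct

variable {P Γ : Type*} [LinearOrder Γ] {ar : P → ℕ} {Pr : Set (Rule ar Γ)} {r : Rule ar Γ}
  {A I S : Set (Atom ar Γ)}

/-- The contribution of the rule `r` to the notion of a model: `I` satisfies all those ground
instances of `r` that belong to the reduct with respect to `A`. -/
def Rule.HoldsInReduct (r : Rule ar Γ) (A I : Set (Atom ar Γ)) : Prop :=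
  ∀ ν, r.BodyHolds A ν → r.BodyHolds I ν → r.HeadHolds I ν

theorem isModel_reduct_iff : IsModel (reduct Pr A) I ↔ ∀ r ∈ Pr, r.HoldsInReduct A I :=
  ⟨fun h r hr ν hA hI => h (r, ν) ⟨hr, hA⟩ hI, fun h g hg hI => h g.1 hg.1 g.2 hg.2 hI⟩

theorem Rule.holdsInReduct_iff_of_bodyHolds_imp (h : ∀ ν, r.BodyHolds I ν → r.BodyHolds A ν) :
    r.HoldsInReduct A I ↔ ∀ ν, r.BodyHolds I ν → r.HeadHolds I ν :=
  forall_congr' fun ν => ⟨fun H hI => H (h ν hI) hI, fun H _ => H⟩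

theorem IsAnswerSet.subset_of_heads_mem (hA : IsAnswerSet Pr A)
    (hS : ∀ r ∈ Pr, ∀ ν, r.BodyHolds A ν → ∀ a ∈ r.head, a.map (Term.eval ν) ∈ S) : A ⊆ S := by
  have hmodel : IsModel (reduct Pr A) (A ∩ S) := by
    rintro ⟨r, ν⟩ ⟨hr, hbody⟩ -
    obtain ⟨a, ha, haA⟩ := hA.prop ⟨r, ν⟩ ⟨hr, hbody⟩ hbody
    exact ⟨a, ha, haA, hS r hr ν hbody a ha⟩
  exact (hA.le_of_le hmodel Set.inter_subset_left).trans Set.inter_subset_right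

end Reduct

theorem SymbolicSet.encard_value {P Γ : Type*} {ar : P → ℕ} (S : SymbolicSet ar Γ)
    (I : Set (Atom ar Γ)) (ν : Var → Γ) :
    (S.value I ν).encard =
      {w : Var → Γ | (∀ x, x ∉ S.vars → w x = ν x) ∧
        ∀ a ∈ S.conj, a.map (Term.eval w) ∈ I}.encard := by
  set W := {w : Var → Γ | (∀ x, x ∉ S.vars → w x = ν x) ∧ ∀ a ∈ S.conj, a.map (Term.eval w) ∈ I}
  have hvalue : S.value I ν = (fun w => S.vars.map w) '' W := by
    ext l
    simp only [SymbolicSet.value, W, Set.mem_image, Set.mem_ofPred_eq, and_assoc, eq_comm (a := l)]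
  have hinj : Set.InjOn (fun w => S.vars.map w) W := by
    intro v hv w hw hvw
    funext x
    by_cases hx : x ∈ S.vars
    · exact List.map_inj_left.1 hvw x hx
    · rw [hv.1 x hx, hw.1 x hx]
  rw [hvalue, hinj.encard_image]

section Witnesses

variable {R Γ : Type*} {ar : R → ℕ} {d : IND ar} {B C : Set (Atom ar Γ)} {ν : Var → Γ}

theorem Atom.map_eq_map_iff {a : Atom ar Var} {v w : Var → Γ} :
    a.map v = a.map w ↔ ∀ x ∈ Set.range a.args, v x = w x := by
  simp [Atom.map, funext_iff]

theorem IND.mem_exVars {x : Var} :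
    x ∈ d.exVars ↔ x ∈ Set.range d.rhs.args ∧ x ∉ Set.range d.lhs.args := by
  simp [IND.exVars, List.mem_filter, List.mem_ofFn]

/-- The valuations of the existential variables, extended by `ν` to all other variables, for
which `B` contains the right-hand side of `d`. -/
def IND.witnesses (d : IND ar) (B : Set (Atom ar Γ)) (ν : Var → Γ) : Set (Var → Γ) :=
  {w | (∀ x, x ∉ d.exVars → w x = ν x) ∧ d.rhs.map w ∈ B}

theorem satisfiesIND_iff :
    SatisfiesIND B d ↔ ∀ ν : Var → Γ, d.lhs.map ν ∈ B → (d.witnesses B ν).Nonempty := by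
  refine forall_congr' fun ν => imp_congr_right fun _ => ⟨?_, ?_⟩
  · rintro ⟨w, hw, hwB⟩
    classical
    let w' : Var → Γ := fun x => if x ∈ d.exVars then w x else ν x
    have hw' : d.rhs.map w' = d.rhs.map w := by
      refine Atom.map_eq_map_iff.2 fun x hx => ?_
      by_cases hl : x ∈ Set.range d.lhs.args
      · rw [hw x ⟨hl, hx⟩]
        exact if_neg fun hex => (IND.mem_exVars.1 hex).2 hl
      · exact if_pos (IND.mem_exVars.2 ⟨hx, hl⟩)
    exact ⟨w', fun x hx => if_neg hx, hw' ▸ hwB⟩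
  · rintro ⟨w, hw, hwB⟩
    exact ⟨w, fun x hx => hw x fun hex => (IND.mem_exVars.1 hex).2 hx.1, hwB⟩

theorem IND.witnesses_mono (h : C ⊆ B) : d.witnesses C ν ⊆ d.witnesses B ν :=
  fun _ hw => ⟨hw.1, h hw.2⟩

theorem IND.witnesses_sdiff : d.witnesses (B \ C) ν = d.witnesses B ν \ d.witnesses C ν := by
  ext w
  exact ⟨fun hw => ⟨⟨hw.1, hw.2.1⟩, fun hwC => hw.2.2 hwC.2⟩,
    fun hw => ⟨hw.1.1, hw.1.2, fun hwC => hw.2 ⟨hw.1.1, hwC⟩⟩⟩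

theorem IND.witnesses_eq_empty_iff_of_exVars_eq_nil (h : d.exVars = []) :
    d.witnesses B ν = ∅ ↔ d.rhs.map ν ∉ B := by
  have hagree (w : Var → Γ) : (∀ x, x ∉ d.exVars → w x = ν x) ↔ w = ν := by simp [h, funext_iff]
  simp [IND.witnesses, hagree, Set.eq_empty_iff_forall_notMem]

theorem IND.finite_witnesses (hB : B.Finite) (d : IND ar) (ν : Var → Γ) :
    (d.witnesses B ν).Finite := by
  refine Set.Finite.of_injOn (f := d.rhs.map) (fun w hw => hw.2) ?_ hB
  intro v hv w hw hvw
  funext x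
  by_cases hx : x ∈ d.exVars
  · exact Atom.map_eq_map_iff.1 hvw x (IND.mem_exVars.1 hx).1
  · rw [hv.1 x hx, hw.1 x hx]

theorem IND.encard_witnesses_eq_iff (hCB : C ⊆ B) (hfin : (d.witnesses B ν).Finite) :
    (d.witnesses C ν).encard = (d.witnesses B ν).encard ↔ d.witnesses (B \ C) ν = ∅ := by
  have hsub : d.witnesses C ν ⊆ d.witnesses B ν := IND.witnesses_mono hCB
  rw [IND.witnesses_sdiff, Set.sdiff_eq_empty]
  exact ⟨fun h => ((hfin.subset hsub).eq_of_subset_of_encard_le hsub h.ge).ge,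
    fun h => congrArg Set.encard (hsub.antisymm h)⟩

/-- Every instance of an inclusion dependency that is triggered by a fact of `D` has only finitely
many witnesses in `D`; the count aggregates of the generated program then count correctly. -/
def FinitelyWitnessed (G : Schema R) (D : Database G Γ) : Prop :=
  ∀ d ∈ G.inds, ∀ ν : Var → Γ, d.lhs.map ν ∈ D → (d.witnesses D ν).Finite

end Witnesses

section Interpretations

variable {R Γ : Type*} {ar : R → ℕ} {n : ℕ}

/-- The interpretation of the generated program in which `g`, `gᶜ`, `gʳ` have the extensions given
by `D`, `C`, `B`, and the query predicate has the extension `Q`. -/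
def cqaInterp (D C B : Set (Atom ar Γ)) (Q : Set (Fin n → Γ)) : Set (Atom (cqaArity ar n) Γ) :=
  {a | match a with
    | ⟨.base g, t⟩ => (⟨g, t⟩ : Atom ar Γ) ∈ D
    | ⟨.del g, t⟩ => (⟨g, t⟩ : Atom ar Γ) ∈ C
    | ⟨.rep g, t⟩ => (⟨g, t⟩ : Atom ar Γ) ∈ B
    | ⟨.query, t⟩ => t ∈ Q}

variable {D C B : Set (Atom ar Γ)} {Q : Set (Fin n → Γ)} {I J : Set (Atom (cqaArity ar n) Γ)}

theorem subset_iff_preimage_subset : I ⊆ J ↔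
    baseAtom n ⁻¹' I ⊆ baseAtom n ⁻¹' J ∧ delAtom n ⁻¹' I ⊆ delAtom n ⁻¹' J ∧
      repAtom n ⁻¹' I ⊆ repAtom n ⁻¹' J ∧ queryAtom ar ⁻¹' I ⊆ queryAtom ar ⁻¹' J := by
  refine ⟨fun h => ⟨Set.preimage_mono h, Set.preimage_mono h, Set.preimage_mono h,
    Set.preimage_mono h⟩, ?_⟩
  rintro ⟨hbase, hdel, hrep, hquery⟩ ⟨g | g | g | _, t⟩ ha
  · exact hbase (a := ⟨g, t⟩) ha
  · exact hdel (a := ⟨g, t⟩) ha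
  · exact hrep (a := ⟨g, t⟩) ha
  · exact hquery ha

theorem subset_cqaInterp_iff : I ⊆ cqaInterp D C B Q ↔
    baseAtom n ⁻¹' I ⊆ D ∧ delAtom n ⁻¹' I ⊆ C ∧ repAtom n ⁻¹' I ⊆ B ∧ queryAtom ar ⁻¹' I ⊆ Q :=
  subset_iff_preimage_subset

theorem cqaInterp_subset_iff : cqaInterp D C B Q ⊆ I ↔
    D ⊆ baseAtom n ⁻¹' I ∧ C ⊆ delAtom n ⁻¹' I ∧ B ⊆ repAtom n ⁻¹' I ∧ Q ⊆ queryAtom ar ⁻¹' I :=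
  subset_iff_preimage_subset

@[simp] theorem map_eval_baseAtom_toTerm (a : Atom ar Var) (ν : Var → Γ) :
    (baseAtom n (a.toTerm Γ)).map (Term.eval ν) = baseAtom n (a.map ν) := rfl

@[simp] theorem map_eval_delAtom_toTerm (a : Atom ar Var) (ν : Var → Γ) :
    (delAtom n (a.toTerm Γ)).map (Term.eval ν) = delAtom n (a.map ν) := rfl

@[simp] theorem map_eval_repAtom_toTerm (a : Atom ar Var) (ν : Var → Γ) :
    (repAtom n (a.toTerm Γ)).map (Term.eval ν) = repAtom n (a.map ν) := rfl

theorem exists_map_genericAtom_eq [Nonempty Γ] (f : Atom ar Γ) :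
    ∃ ν : Var → Γ, (genericAtom ar f.pred).map ν = f := by
  obtain ⟨ν, hν⟩ := Fin.val_injective.surjective_comp_right f.args
  exact ⟨ν, Atom.ext rfl (heq_of_eq hν)⟩

end Interpretations

section Heads

variable {R Γ : Type*} {ar : R → ℕ} {n : ℕ} {I : Set (Atom (cqaArity ar n) Γ)} {ν : Var → Γ}

theorem factRule_headHolds {f : Atom ar Γ} :
    (factRule n f).HeadHolds I ν ↔ baseAtom n f ∈ I := by
  simp only [Rule.HeadHolds, factRule, List.mem_singleton, exists_eq_left]
  exact Iff.rfl

theorem dcRule_headHolds {c : Conj ar} :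
    (dcRule Γ n c).HeadHolds I ν ↔ ∃ a ∈ c.atoms, a.map ν ∈ delAtom n ⁻¹' I := by
  simp [Rule.HeadHolds, dcRule]

theorem head_eq_of_mem_indRules {d : IND ar} {r : Rule (cqaArity ar n) Γ}
    (hr : r ∈ indRules Γ n d) : r.head = [delAtom n (d.lhs.toTerm Γ)] := by
  rcases hr with ⟨-, rfl⟩ | ⟨-, rfl | rfl⟩ <;> rfl

theorem headHolds_iff_of_mem_indRules {d : IND ar} {r : Rule (cqaArity ar n) Γ}
    (hr : r ∈ indRules Γ n d) : r.HeadHolds I ν ↔ d.lhs.map ν ∈ delAtom n ⁻¹' I := by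
  simp [Rule.HeadHolds, head_eq_of_mem_indRules hr]

theorem repRule_headHolds {g : R} :
    (repRule ar Γ n g).HeadHolds I ν ↔ (genericAtom ar g).map ν ∈ repAtom n ⁻¹' I := by
  simp [Rule.HeadHolds, repRule]

theorem queryRule_headHolds {q : UCQ ar} {I : Set (Atom (cqaArity ar q.arity) Γ)} {c : Conj ar} :
    (queryRule Γ q c).HeadHolds I ν ↔ (fun i => ν (q.free i)) ∈ queryAtom ar ⁻¹' I := by
  simp only [Rule.HeadHolds, queryRule, List.mem_singleton, exists_eq_left]
  exact Iff.rfl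

end Heads

section Bodies

variable {R Γ : Type*} [LinearOrder Γ] {ar : R → ℕ} {n : ℕ} {I : Set (Atom (cqaArity ar n) Γ)}
  {ν : Var → Γ} {d : IND ar} {r : Rule (cqaArity ar n) Γ}

theorem factRule_bodyHolds {f : Atom ar Γ} : (factRule n f).BodyHolds I ν := by
  simp [Rule.BodyHolds, factRule]

theorem dcRule_bodyHolds {c : Conj ar} :
    (dcRule Γ n c).BodyHolds I ν ↔ c.Holds (baseAtom n ⁻¹' I) ν := by
  simp [Rule.BodyHolds, dcRule, Conj.Holds, Literal.Holds, compLit, Term.eval, or_imp, forall_and]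

theorem queryRule_bodyHolds {q : UCQ ar} {I : Set (Atom (cqaArity ar q.arity) Γ)} {c : Conj ar} :
    (queryRule Γ q c).BodyHolds I ν ↔ c.Holds (repAtom q.arity ⁻¹' I) ν := by
  simp [Rule.BodyHolds, queryRule, Conj.Holds, Literal.Holds, compLit, Term.eval, or_imp,
    forall_and]

theorem repRule_bodyHolds {g : R} :
    (repRule ar Γ n g).BodyHolds I ν ↔
      (genericAtom ar g).map ν ∈ baseAtom n ⁻¹' I \ delAtom n ⁻¹' I := by
  simp [Rule.BodyHolds, repRule, Literal.Holds]

theorem indDelRule_bodyHolds :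
    (indDelRule Γ n d).BodyHolds I ν ↔
      d.lhs.map ν ∈ baseAtom n ⁻¹' I ∧ d.rhs.map ν ∈ delAtom n ⁻¹' I := by
  simp [Rule.BodyHolds, indDelRule, Literal.Holds]

theorem indNotRule_bodyHolds :
    (indNotRule Γ n d).BodyHolds I ν ↔
      d.lhs.map ν ∈ baseAtom n ⁻¹' I ∧ d.rhs.map ν ∉ baseAtom n ⁻¹' I := by
  simp [Rule.BodyHolds, indNotRule, Literal.Holds]

theorem indCountRule_bodyHolds (hdel : delAtom n ⁻¹' I ⊆ baseAtom n ⁻¹' I)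
    (hfin : d.lhs.map ν ∈ baseAtom n ⁻¹' I → (d.witnesses (baseAtom n ⁻¹' I) ν).Finite) :
    (indCountRule Γ n d).BodyHolds I ν ↔ d.lhs.map ν ∈ baseAtom n ⁻¹' I ∧
      d.witnesses (baseAtom n ⁻¹' I \ delAtom n ⁻¹' I) ν = ∅ := by
  have hcount : (indCountRule Γ n d).BodyHolds I ν ↔ d.lhs.map ν ∈ baseAtom n ⁻¹' I ∧
      (d.witnesses (delAtom n ⁻¹' I) ν).encard = (d.witnesses (baseAtom n ⁻¹' I) ν).encard := by
    simp [Rule.BodyHolds, indCountRule, Literal.Holds, SymbolicSet.encard_value, IND.witnesses]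
  rw [hcount]
  exact and_congr_right fun hl => IND.encard_witnesses_eq_iff hdel (hfin hl)

theorem lhs_mem_of_mem_indRules (hr : r ∈ indRules Γ n d) (h : r.BodyHolds I ν) :
    d.lhs.map ν ∈ baseAtom n ⁻¹' I := by
  rcases hr with ⟨-, rfl⟩ | ⟨-, rfl | rfl⟩
  · exact h (.pos (baseAtom n (d.lhs.toTerm Γ))) List.mem_cons_self
  · exact (indDelRule_bodyHolds.1 h).1
  · exact (indNotRule_bodyHolds.1 h).1

theorem exists_mem_indRules_bodyHolds_iff (hdel : delAtom n ⁻¹' I ⊆ baseAtom n ⁻¹' I)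
    (hfin : d.lhs.map ν ∈ baseAtom n ⁻¹' I → (d.witnesses (baseAtom n ⁻¹' I) ν).Finite) :
    (∃ r ∈ indRules Γ n d, r.BodyHolds I ν) ↔ d.lhs.map ν ∈ baseAtom n ⁻¹' I ∧
      d.witnesses (baseAtom n ⁻¹' I \ delAtom n ⁻¹' I) ν = ∅ := by
  rcases Nat.eq_zero_or_pos d.exVars.length with hzero | hpos
  · have hrules : (∃ r ∈ indRules Γ n d, r.BodyHolds I ν) ↔
        (indDelRule Γ n d).BodyHolds I ν ∨ (indNotRule Γ n d).BodyHolds I ν := by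
      simp [indRules, hzero, or_and_right, exists_or]
    rw [hrules, indDelRule_bodyHolds, indNotRule_bodyHolds,
      IND.witnesses_eq_empty_iff_of_exVars_eq_nil (List.length_eq_zero_iff.1 hzero), Set.mem_sdiff]
    tauto
  · have hrules : (∃ r ∈ indRules Γ n d, r.BodyHolds I ν) ↔
        (indCountRule Γ n d).BodyHolds I ν := by
      simp [indRules, hpos, hpos.ne']
    rw [hrules, indCountRule_bodyHolds hdel hfin]

theorem bodyHolds_mono_of_mem_indRules {A : Set (Atom (cqaArity ar n) Γ)}
    (hr : r ∈ indRules Γ n d) (hIA : I ⊆ A) (hbase : baseAtom n ⁻¹' I = baseAtom n ⁻¹' A)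
    (hdel : delAtom n ⁻¹' A ⊆ baseAtom n ⁻¹' A)
    (hfin : d.lhs.map ν ∈ baseAtom n ⁻¹' A → (d.witnesses (baseAtom n ⁻¹' A) ν).Finite)
    (h : r.BodyHolds I ν) : r.BodyHolds A ν := by
  have hdelIA : delAtom n ⁻¹' I ⊆ delAtom n ⁻¹' A := Set.preimage_mono hIA
  rcases hr with ⟨-, rfl⟩ | ⟨-, rfl | rfl⟩
  · rw [indCountRule_bodyHolds (hbase ▸ hdelIA.trans hdel) (hbase ▸ hfin), hbase] at h
    exact (indCountRule_bodyHolds hdel hfin).2 ⟨h.1, Set.subset_eq_empty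
      (IND.witnesses_mono (Set.sdiff_subset_sdiff_right hdelIA)) h.2⟩
  · rw [indDelRule_bodyHolds] at h ⊢
    exact ⟨hIA h.1, hdelIA h.2⟩
  · rwa [indNotRule_bodyHolds, ← hbase, ← indNotRule_bodyHolds]

end Bodies

section RulesInReduct

variable {R Γ : Type*} [LinearOrder Γ] {ar : R → ℕ} {n : ℕ} {A I : Set (Atom (cqaArity ar n) Γ)}

theorem Conj.Holds.mono {c : Conj ar} {B B' : Set (Atom ar Γ)} {ν : Var → Γ}
    (h : c.Holds B ν) (hB : B ⊆ B') : c.Holds B' ν :=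
  ⟨fun a ha => hB (h.1 a ha), h.2⟩

theorem satisfiesDC_sdiff_iff {c : Conj ar} {B C : Set (Atom ar Γ)} :
    SatisfiesDC (B \ C) c ↔ ∀ ν : Var → Γ, c.Holds B ν → ∃ a ∈ c.atoms, a.map ν ∈ C := by
  refine forall_congr' fun ν => ⟨fun h hB => ?_, fun h hBC => ?_⟩
  · by_contra! hC
    exact h ⟨fun a ha => ⟨hB.1 a ha, hC a ha⟩, hB.2⟩
  · obtain ⟨a, ha, haC⟩ := h (hBC.mono Set.sdiff_subset)
    exact (hBC.1 a ha).2 haC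

theorem factRule_holdsInReduct [Nonempty Γ] {f : Atom ar Γ} :
    (factRule n f).HoldsInReduct A I ↔ f ∈ baseAtom n ⁻¹' I := by
  simp [Rule.HoldsInReduct, factRule_bodyHolds, factRule_headHolds]

theorem dcRule_holdsInReduct (hIA : I ⊆ A) {c : Conj ar} :
    (dcRule Γ n c).HoldsInReduct A I ↔ SatisfiesDC (baseAtom n ⁻¹' I \ delAtom n ⁻¹' I) c := by
  rw [Rule.holdsInReduct_iff_of_bodyHolds_imp fun ν h =>
    dcRule_bodyHolds.2 ((dcRule_bodyHolds.1 h).mono (Set.preimage_mono hIA)), satisfiesDC_sdiff_iff]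
  simp only [dcRule_bodyHolds, dcRule_headHolds]

theorem indRules_holdsInReduct {d : IND ar} (hIA : I ⊆ A)
    (hbase : baseAtom n ⁻¹' I = baseAtom n ⁻¹' A) (hdel : delAtom n ⁻¹' A ⊆ baseAtom n ⁻¹' A)
    (hfin : ∀ ν, d.lhs.map ν ∈ baseAtom n ⁻¹' A → (d.witnesses (baseAtom n ⁻¹' A) ν).Finite) :
    (∀ r ∈ indRules Γ n d, r.HoldsInReduct A I) ↔
      SatisfiesIND (baseAtom n ⁻¹' I \ delAtom n ⁻¹' I) d := by
  have hdelI : delAtom n ⁻¹' I ⊆ baseAtom n ⁻¹' I :=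
    hbase ▸ (Set.preimage_mono hIA).trans hdel
  calc (∀ r ∈ indRules Γ n d, r.HoldsInReduct A I)
    _ ↔ ∀ r ∈ indRules Γ n d, ∀ ν, r.BodyHolds I ν → d.lhs.map ν ∈ delAtom n ⁻¹' I := by
        refine forall₂_congr fun r hr => ?_
        simp only [Rule.holdsInReduct_iff_of_bodyHolds_imp fun ν =>
          bodyHolds_mono_of_mem_indRules hr hIA hbase hdel (hfin ν),
          headHolds_iff_of_mem_indRules hr]
    _ ↔ ∀ ν, (∃ r ∈ indRules Γ n d, r.BodyHolds I ν) → d.lhs.map ν ∈ delAtom n ⁻¹' I := by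
        grind
    _ ↔ ∀ ν, d.lhs.map ν ∈ baseAtom n ⁻¹' I ∧
          d.witnesses (baseAtom n ⁻¹' I \ delAtom n ⁻¹' I) ν = ∅ →
            d.lhs.map ν ∈ delAtom n ⁻¹' I :=
        forall_congr' fun ν => by
          rw [exists_mem_indRules_bodyHolds_iff hdelI (hbase ▸ hfin ν)]
    _ ↔ SatisfiesIND (baseAtom n ⁻¹' I \ delAtom n ⁻¹' I) d := by
        simp only [satisfiesIND_iff, Set.mem_sdiff, Set.nonempty_iff_ne_empty]
        grind

theorem repRule_holdsInReduct [Nonempty Γ] (hIA : I ⊆ A) :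
    (∀ g, (repRule ar Γ n g).HoldsInReduct A I) ↔
      baseAtom n ⁻¹' I \ delAtom n ⁻¹' A ⊆ repAtom n ⁻¹' I := by
  simp only [Rule.HoldsInReduct, repRule_bodyHolds, repRule_headHolds]
  refine ⟨fun h f hf => ?_, fun h g ν hA hI => h ⟨hI.1, hA.2⟩⟩
  obtain ⟨ν, hν⟩ := exists_map_genericAtom_eq f
  rw [← hν] at hf ⊢
  exact h f.pred ν ⟨hIA hf.1, hf.2⟩ ⟨hf.1, fun hdel => hf.2 (hIA hdel)⟩

theorem queryRule_holdsInReduct {q : UCQ ar} {A I : Set (Atom (cqaArity ar q.arity) Γ)}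
    (hIA : I ⊆ A) :
    (∀ c ∈ q.disjuncts, (queryRule Γ q c).HoldsInReduct A I) ↔
      q.ans (repAtom q.arity ⁻¹' I) ⊆ queryAtom ar ⁻¹' I := by
  have hmono (c : Conj ar) (ν : Var → Γ) (h : (queryRule Γ q c).BodyHolds I ν) :
      (queryRule Γ q c).BodyHolds A ν :=
    queryRule_bodyHolds.2 ((queryRule_bodyHolds.1 h).mono (Set.preimage_mono hIA))
  simp only [Rule.holdsInReduct_iff_of_bodyHolds_imp (hmono _), queryRule_bodyHolds,
    queryRule_headHolds]
  constructor
  · rintro h t ⟨c, hc, ν, hν, hholds⟩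
    exact funext hν ▸ h c hc ν hholds
  · exact fun h c hc ν hholds => h ⟨c, hc, ν, fun _ => rfl, hholds⟩

end RulesInReduct

section Program

variable {R Γ : Type*} {G : Schema R} {D : Database G Γ} {q : UCQ G.arity}

theorem forall_mem_program_iff {p : Rule (cqaArity G.arity q.arity) Γ → Prop} :
    (∀ r ∈ factProgram D q.arity ∪ Pcqa G Γ q, p r) ↔
      (∀ f ∈ D, p (factRule q.arity f)) ∧ (∀ c ∈ G.dcs, p (dcRule Γ q.arity c)) ∧
        (∀ d ∈ G.inds, ∀ r ∈ indRules Γ q.arity d, p r) ∧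
          (∀ g, p (repRule G.arity Γ q.arity g)) ∧ ∀ c ∈ q.disjuncts, p (queryRule Γ q c) := by
  simp only [factProgram, Pcqa, Set.mem_union, Set.mem_image, Set.mem_ofPred_eq]
  grind

variable [LinearOrder Γ]

/-- The candidate answer set for the subset `B` of `D`: exactly the facts in `D \ B` are deleted. -/
def repairInterp (D : Database G Γ) (q : UCQ G.arity) (B : Database G Γ) :
    Set (Atom (cqaArity G.arity q.arity) Γ) :=
  cqaInterp D (D \ B) B (q.ans B)

variable {A I : Set (Atom (cqaArity G.arity q.arity) Γ)} {B : Database G Γ}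

theorem isCMRepair_iff_maximal :
    IsCMRepair G D B ↔ Maximal (fun B' => B' ⊆ D ∧ Consistent G B') B := by
  rw [maximal_iff_forall_gt, IsCMRepair]
  grind

theorem IsAnswerSet.subset_cqaInterp (hA : IsAnswerSet (factProgram D q.arity ∪ Pcqa G Γ q) A) :
    A ⊆ cqaInterp D (baseAtom q.arity ⁻¹' A) (baseAtom q.arity ⁻¹' A \ delAtom q.arity ⁻¹' A)
      (q.ans (repAtom q.arity ⁻¹' A)) := by
  refine hA.subset_of_heads_mem (forall_mem_program_iff.2 ⟨fun f hf ν _ => ?_,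
    fun c _ ν hbody => ?_, fun d _ r hr ν hbody => ?_, fun g ν hbody => ?_, fun c hc ν hbody => ?_⟩)
  · exact List.forall_mem_singleton.2 hf
  · exact List.forall_mem_map.2 (dcRule_bodyHolds.1 hbody).1
  · rw [head_eq_of_mem_indRules hr]
    exact List.forall_mem_singleton.2 (lhs_mem_of_mem_indRules hr hbody)
  · exact List.forall_mem_singleton.2 (repRule_bodyHolds.1 hbody)
  · exact List.forall_mem_singleton.2 ⟨c, hc, ν, fun _ => rfl, queryRule_bodyHolds.1 hbody⟩

theorem IsAnswerSet.repairedDB_subset (hA : IsAnswerSet (factProgram D q.arity ∪ Pcqa G Γ q) A) :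
    repairedDB G A ⊆ D := by
  obtain ⟨hbase, -, hrep, -⟩ := subset_cqaInterp_iff.1 hA.subset_cqaInterp
  exact hrep.trans (Set.sdiff_subset.trans hbase)

variable [Nonempty Γ]

theorem isModel_reduct_program_iff (hfin : FinitelyWitnessed G D) (hIA : I ⊆ A)
    (hbase : baseAtom q.arity ⁻¹' A = D) (hdel : delAtom q.arity ⁻¹' A ⊆ D) :
    IsModel (reduct (factProgram D q.arity ∪ Pcqa G Γ q) A) I ↔
      D ⊆ baseAtom q.arity ⁻¹' I ∧ Consistent G (D \ delAtom q.arity ⁻¹' I) ∧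
        D \ delAtom q.arity ⁻¹' A ⊆ repAtom q.arity ⁻¹' I ∧
          q.ans (repAtom q.arity ⁻¹' I) ⊆ queryAtom G.arity ⁻¹' I := by
  rw [isModel_reduct_iff, forall_mem_program_iff]
  simp only [factRule_holdsInReduct]
  refine and_congr_right fun hD => ?_
  have hbaseI : baseAtom q.arity ⁻¹' I = D := ((Set.preimage_mono hIA).trans hbase.le).antisymm hD
  have hind : (∀ d ∈ G.inds, ∀ r ∈ indRules Γ q.arity d, r.HoldsInReduct A I) ↔
      ∀ d ∈ G.inds, SatisfiesIND (D \ delAtom q.arity ⁻¹' I) d := by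
    refine forall₂_congr fun d hd => ?_
    rw [indRules_holdsInReduct hIA (hbaseI.trans hbase.symm) (hbase.symm ▸ hdel)
      (hbase.symm ▸ hfin d hd), hbaseI]
  simp only [hind, dcRule_holdsInReduct hIA, repRule_holdsInReduct hIA,
    queryRule_holdsInReduct hIA, hbaseI, Consistent, and_assoc]

theorem IsAnswerSet.eq_repairInterp (hfin : FinitelyWitnessed G D)
    (hA : IsAnswerSet (factProgram D q.arity ∪ Pcqa G Γ q) A) :
    A = repairInterp D q (repAtom q.arity ⁻¹' A) := by
  obtain ⟨hbaseD, hdel, hrep, hquery⟩ := subset_cqaInterp_iff.1 hA.subset_cqaInterp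
  have hD : D ⊆ baseAtom q.arity ⁻¹' A := fun f hf => factRule_holdsInReduct.1
    ((forall_mem_program_iff.1 (isModel_reduct_iff.1 hA.prop)).1 f hf)
  have hbase : baseAtom q.arity ⁻¹' A = D := hbaseD.antisymm hD
  rw [hbase] at hdel hrep
  obtain ⟨-, -, hrep', hquery'⟩ :=
    (isModel_reduct_program_iff hfin subset_rfl hbase hdel).1 hA.prop
  have hrepA : repAtom q.arity ⁻¹' A = D \ delAtom q.arity ⁻¹' A := hrep.antisymm hrep'
  have hdelA : delAtom q.arity ⁻¹' A = D \ repAtom q.arity ⁻¹' A := by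
    rw [hrepA, Set.sdiff_sdiff_cancel_left hdel]
  exact (subset_cqaInterp_iff.2 ⟨hbase.le, hdelA.le, subset_rfl, hquery⟩).antisymm
    (cqaInterp_subset_iff.2 ⟨hbase.ge, hdelA.ge, subset_rfl, hquery'⟩)

theorem isModel_reduct_repairInterp_iff (hfin : FinitelyWitnessed G D) (hBD : B ⊆ D)
    (hI : I ⊆ repairInterp D q B) :
    IsModel (reduct (factProgram D q.arity ∪ Pcqa G Γ q) (repairInterp D q B)) I ↔
      Consistent G (D \ delAtom q.arity ⁻¹' I) ∧
        cqaInterp D (delAtom q.arity ⁻¹' I) B (q.ans B) ⊆ I := by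
  have hdel : D \ delAtom q.arity ⁻¹' repairInterp D q B = B := Set.sdiff_sdiff_cancel_left hBD
  rw [isModel_reduct_program_iff hfin hI rfl Set.sdiff_subset, hdel, cqaInterp_subset_iff]
  have hrep (h : B ⊆ repAtom q.arity ⁻¹' I) : repAtom q.arity ⁻¹' I = B :=
    (subset_cqaInterp_iff.1 hI).2.2.1.antisymm h
  constructor
  · rintro ⟨hD, hcons, hB, hans⟩
    exact ⟨hcons, hD, subset_rfl, hB, by rwa [hrep hB] at hans⟩
  · rintro ⟨hcons, hD, -, hB, hans⟩
    exact ⟨hD, hcons, hB, by rwa [hrep hB]⟩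

theorem isModel_reduct_repairInterp_self_iff (hfin : FinitelyWitnessed G D) (hBD : B ⊆ D) :
    IsModel (reduct (factProgram D q.arity ∪ Pcqa G Γ q) (repairInterp D q B))
      (repairInterp D q B) ↔ Consistent G B := by
  have hdel : D \ delAtom q.arity ⁻¹' repairInterp D q B = B := Set.sdiff_sdiff_cancel_left hBD
  rw [isModel_reduct_repairInterp_iff hfin hBD subset_rfl, hdel]
  exact and_iff_left subset_rfl

theorem IsAnswerSet.isCMRepair (hfin : FinitelyWitnessed G D) (hBD : B ⊆ D)
    (hA : IsAnswerSet (factProgram D q.arity ∪ Pcqa G Γ q) (repairInterp D q B)) :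
    IsCMRepair G D B := by
  refine isCMRepair_iff_maximal.2
    ⟨⟨hBD, (isModel_reduct_repairInterp_self_iff hfin hBD).1 hA.prop⟩, ?_⟩
  rintro B' ⟨hB'D, hB'⟩ (hBB' : B ⊆ B')
  let I := cqaInterp D (D \ B') B (q.ans B)
  have hIA : I ⊆ repairInterp D q B := cqaInterp_subset_iff.2
    ⟨subset_rfl, Set.sdiff_subset_sdiff_right hBB', subset_rfl, subset_rfl⟩
  have hI : IsModel (reduct (factProgram D q.arity ∪ Pcqa G Γ q) (repairInterp D q B)) I := by
    have hdel : D \ delAtom q.arity ⁻¹' I = B' := Set.sdiff_sdiff_cancel_left hB'D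
    exact (isModel_reduct_repairInterp_iff hfin hBD hIA).2 ⟨hdel.symm ▸ hB', subset_rfl⟩
  have hdel : D \ B ⊆ D \ B' := (subset_cqaInterp_iff.1 (hA.le_of_le hI hIA)).2.1
  exact (Set.sdiff_subset_sdiff_iff_subset hBD hB'D).1 hdel

theorem IsCMRepair.isAnswerSet (hfin : FinitelyWitnessed G D) (hB : IsCMRepair G D B) :
    IsAnswerSet (factProgram D q.arity ∪ Pcqa G Γ q) (repairInterp D q B) := by
  obtain ⟨⟨hBD, hcons⟩, hmax⟩ := isCMRepair_iff_maximal.1 hB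
  refine ⟨(isModel_reduct_repairInterp_self_iff hfin hBD).2 hcons, fun I hI hIA => ?_⟩
  obtain ⟨hconsI, hsub⟩ := (isModel_reduct_repairInterp_iff hfin hBD hIA).1 hI
  have hdel : delAtom q.arity ⁻¹' I ⊆ D \ B := (subset_cqaInterp_iff.1 hIA).2.1
  have hBdel : B ⊆ D \ delAtom q.arity ⁻¹' I := fun f hf => ⟨hBD hf, fun hfI => (hdel hfI).2 hf⟩
  have hdelB : D \ delAtom q.arity ⁻¹' I ⊆ B := hmax ⟨Set.sdiff_subset, hconsI⟩ hBdel
  have hdelI : D \ B ⊆ delAtom q.arity ⁻¹' I := sdiff_le_comm.1 hdelB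
  have hA : repairInterp D q B ⊆ cqaInterp D (delAtom q.arity ⁻¹' I) B (q.ans B) :=
    cqaInterp_subset_iff.2 ⟨subset_rfl, hdelI, subset_rfl, subset_rfl⟩
  exact hA.trans hsub

theorem bijOn_repairedDB (hfin : FinitelyWitnessed G D) :
    Set.BijOn (repairedDB G) {A | IsAnswerSet (factProgram D q.arity ∪ Pcqa G Γ q) A}
      {B | IsCMRepair G D B} := by
  have hinv : Set.InvOn (repairInterp D q) (repairedDB G)
      {A | IsAnswerSet (factProgram D q.arity ∪ Pcqa G Γ q) A} {B | IsCMRepair G D B} :=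
    ⟨fun A hA => (hA.eq_repairInterp hfin).symm, fun B _ => rfl⟩
  refine hinv.bijOn (fun A hA => ?_) fun B hB => hB.isAnswerSet hfin
  have hArep : IsAnswerSet (factProgram D q.arity ∪ Pcqa G Γ q)
      (repairInterp D q (repairedDB G A)) := hA.eq_repairInterp hfin ▸ hA
  exact hArep.isCMRepair hfin hA.repairedDB_subset

end Program

end CQA

theorem mainTheorem5_general {R Γ : Type*} [LinearOrder Γ] [Nonempty Γ]
    (G : CQA.Schema R) (D : CQA.Database G Γ) (hfin : CQA.FinitelyWitnessed G D)
    (q : CQA.UCQ G.arity) :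
    (∀ t : Fin q.arity → Γ,
      t ∈ CQA.ansCM G D q ↔
        CQA.CautiousConsequence (CQA.factProgram D q.arity ∪ CQA.Pcqa G Γ q)
          (CQA.queryAtom G.arity t)) ∧
    Set.BijOn (CQA.repairedDB G)
      {A | CQA.IsAnswerSet (CQA.factProgram D q.arity ∪ CQA.Pcqa G Γ q) A}
      {B | CQA.IsCMRepair G D B} := by
  have hbij := CQA.bijOn_repairedDB (q := q) hfin
  refine ⟨fun t => ?_, hbij⟩
  calc t ∈ CQA.ansCM G D q
    _ ↔ ∀ A, CQA.IsAnswerSet (CQA.factProgram D q.arity ∪ CQA.Pcqa G Γ q) A →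
          t ∈ q.ans (CQA.repairedDB G A) := hbij.forall
    _ ↔ ∀ A, CQA.IsAnswerSet (CQA.factProgram D q.arity ∪ CQA.Pcqa G Γ q) A →
          CQA.queryAtom G.arity t ∈ A := by
        refine forall₂_congr fun A hA => ?_
        rw [hA.eq_repairInterp hfin]
        rfl

theorem mainTheorem5 {R Γ : Type*} [LinearOrder Γ] [Countable Γ] [Infinite Γ]
    (G : CQA.Schema R) (D : CQA.Database G Γ) (hD : D.Finite) (q : CQA.UCQ G.arity) :
    (∀ t : Fin q.arity → Γ,
      t ∈ CQA.ansCM G D q ↔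
        CQA.CautiousConsequence (CQA.factProgram D q.arity ∪ CQA.Pcqa G Γ q)
          (CQA.queryAtom G.arity t)) ∧
    Set.BijOn (CQA.repairedDB G)
      {A | CQA.IsAnswerSet (CQA.factProgram D q.arity ∪ CQA.Pcqa G Γ q) A}
      {B | CQA.IsCMRepair G D B} :=
  mainTheorem5_general G D (fun d _ ν _ => d.finite_witnesses hD ν) q
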